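/- **Proposition.** Let $X$ be a simplicial set. For a vertex $x_0$ of $X$, let $\pi_n(X,x_0)$ denote the $n$-th homotopy group of $X$ (the set of path components if $n=0$), i.e. the $n$-th simplicial homotopy group of a Kan fibrant replacement of $X$, based at the image of $x_0$. Call $X$ *$\pi$-finite* if $\pi_n(X,x_0)$ is finite for each $n\ge 0$ and each vertex $x_0$, and if moreover there exists an $n_0$ such that $\pi_n(X,x_0)$ is trivial (has exactly one element) for each $n\ge n_0$ and each vertex $x_0$. Call a simplicial set $L$ *lean* if the set $L_n$ is finite for every $n \geq 0$ and there exists an $n\in\mathbb N$ such that $L$ is $n$-coskeletal, i.e. the canonical map $L\to\operatorname{cosk}_n L$ is an isomorphism, where $\operatorname{cosk}_n L$ is the right Kan extension along $\Delta_{\le n}^{op}\hookrightarrow\Delta^{op}$ of the restriction of $L$ to $\Delta_{\le n}^{op}$. Then $X$ is $\pi$-finite if and only if there exists a Kan complex $L$ that is lean and weakly equivalent to $X$, where weakly equivalent means connected by a finite zigzag of weak homotopy equivalences of simplicial sets (the weak equivalences of the Kan–Quillen model structure). -/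

import Mathlib

open CategoryTheory Simplicial MonoidalCategory HomotopicalAlgebra

universe u

namespace SSet

noncomputable section

/-- The set `[X, Z]` of simplicial homotopy classes of maps `X ⟶ Z`: the quotient of the set of
maps by the equivalence relation generated by `SSet.Homotopy`. (When `Z` is a Kan complex,
`SSet.Homotopy` already is an equivalence relation.) -/
def MapClasses (X Z : SSet.{u}) : Type u :=
  Quot (fun f g : X ⟶ Z => Nonempty (SSet.Homotopy f g))

/-- The map `[Y, Z] → [X, Z]` given by precomposition with `f : X ⟶ Y`. -/
def MapClasses.precomp {X Y : SSet.{u}} (f : X ⟶ Y) (Z : SSet.{u}) :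
    MapClasses Y Z → MapClasses X Z :=
  Quot.map (fun g => f ≫ g) (by
    rintro g g' ⟨H⟩
    exact ⟨{
      h := f ▷ _ ≫ H.h
      h₀ := by
        change _ = f ≫ g
        rw [ι₀_comp_assoc, H.h₀]
      h₁ := by
        change _ = f ≫ g'
        rw [ι₁_comp_assoc, H.h₁]
      rel := by ext _ ⟨⟨x, hx⟩, _⟩; exact hx.elim }⟩)

/-- Weak (homotopy) equivalences of simplicial sets, i.e. the weak equivalences of the Kan–Quillen
model structure: the maps `f : X ⟶ Y` such that `f^* : [Y, Z] → [X, Z]` is bijective for every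
Kan complex `Z`. -/
def IsWeakEquivalence {X Y : SSet.{u}} (f : X ⟶ Y) : Prop :=
  ∀ Z : SSet.{u}, KanComplex Z → Function.Bijective (MapClasses.precomp f Z)

/-- Two simplicial sets are weakly equivalent if they are connected by a finite zigzag of weak
equivalences. -/
def WeaklyEquivalent : SSet.{u} → SSet.{u} → Prop :=
  Relation.EqvGen (fun X Y => ∃ f : X ⟶ Y, IsWeakEquivalence f)

/-- The factorization of `X ⟶ ⊤_` as an anodyne extension followed by a Kan fibration. -/
def kanReplacementData (X : SSet.{u}) :
    MorphismProperty.MapFactorizationData modelCategoryQuillen.J.{u}.rlp.llp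
      modelCategoryQuillen.J.{u}.rlp (Limits.terminal.from X) :=
  MorphismProperty.factorizationData _ _ _

/-- A Kan complex `K` equipped with an anodyne extension `X ⟶ K` (a fibrant replacement). -/
def kanReplacement (X : SSet.{u}) : SSet.{u} := (kanReplacementData X).Z

/-- The anodyne extension from `X` to its fibrant replacement. -/
def toKanReplacement (X : SSet.{u}) : X ⟶ kanReplacement X := (kanReplacementData X).i

lemma anodyneExtensions_toKanReplacement (X : SSet.{u}) :
    anodyneExtensions (toKanReplacement X) :=
  (kanReplacementData X).hi

open modelCategoryQuillen in
lemma kanComplex_kanReplacement (X : SSet.{u}) : KanComplex (kanReplacement X) := by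
  have h : Fibration (kanReplacementData X).p := by
    rw [fibration_iff]
    exact (kanReplacementData X).hp
  rw [KanComplex, isFibrant_iff]
  rwa [Subsingleton.elim (Limits.terminal.from (kanReplacement X)) (kanReplacementData X).p]

/-- For a vertex `x` of a simplicial set `K`, the set of `n`-simplices `Δ[n] ⟶ K` which are constant
with value `x` on `∂Δ[n]`, up to homotopy relative to `∂Δ[n]`. When `K` is a Kan complex, this is
the `n`-th homotopy group (set of path components if `n = 0`) of `K` at `x`; it always contains
the class of the constant simplex. -/
def SimplicialHomotopyGroup (n : ℕ) (K : SSet.{u}) (x : K _⦋0⦌) : Type u :=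
  RelativeMorphism.HomotopyClass (boundary n) (Subcomplex.ofSimplex x)
    (const ⟨x, Subcomplex.mem_ofSimplex_obj x⟩)

/-- The homotopy groups `π_n(X, x)` of an arbitrary simplicial set `X`, which are those of a
fibrant replacement of `X`. -/
def HomotopyGroup (n : ℕ) (X : SSet.{u}) (x : X _⦋0⦌) : Type u :=
  SimplicialHomotopyGroup n (kanReplacement X) ((toKanReplacement X).app _ x)

/-- `X` is `π`-finite: all `π_n(X, x)` are finite, and there is `n₀` such that `π_n(X, x)` is
trivial for all `n ≥ n₀` and all vertices `x`. -/
structure IsPiFinite (X : SSet.{u}) : Prop where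
  finite (n : ℕ) (x : X _⦋0⦌) : Finite (HomotopyGroup n X x)
  exists_trivial : ∃ n₀ : ℕ, ∀ n : ℕ, n₀ ≤ n → ∀ x : X _⦋0⦌, Subsingleton (HomotopyGroup n X x)

/-- `X` is lean: it is degreewise finite, and there is `n` such that `X` is `n`-coskeletal, i.e.
`X ⟶ cosk_n X` is an isomorphism (`SimplicialObject.isCoskeletal_iff_isIso`). -/
structure IsLean (X : SSet.{u}) : Prop where
  finite (n : ℕ) : Finite (X _⦋n⦌)
  exists_isCoskeletal : ∃ n : ℕ, SimplicialObject.IsCoskeletal X n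

end

end SSet

/-! Let K be the Kan replacement of X. Everything rests on homotopy relative to a subcomplex
(`HtpyRel`) in Kan complexes, and on transporting such homotopies along free ones
(`HtpyRel.transport`).

If X is weakly equivalent to a lean Kan complex L, the induced natural bijections on homotopy
classes of maps exhibit K as a homotopy retract of L, by a Yoneda argument. The homotopy sets of K
therefore inject into those of L. The latter are finite because L is degreewise finite, and trivial
above N if L is N-coskeletal, since a simplex of dimension greater than N is determined by its
boundary.

Conversely, Zorn's lemma gives a maximal minimal subcomplex L of K. Maximality makes L compressing
(`isCompressing_of_maximal`), and a compressing subcomplex is a deformation retract, so L is Kan and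
weakly equivalent to X. By minimality, the n-simplices of L with a prescribed boundary inject into
some `HomotopyGroup n X x` (`IsMinimal.exists_injective`). Finiteness of these sets gives degreewise
finiteness by induction on n. Their triviality in large degrees says that large simplices are
determined by their faces, which for a Kan complex forces coskeletality (`KanComplex.isCoskeletal`).
-/

namespace SSet

open CartesianMonoidalCategory Opposite

/-! ### Extending partially defined maps into Kan complexes -/

/-- A functional relation that is compatible with the simplicial structure defines a morphism. -/
lemma exists_hom_of_rel {W K : SSet.{u}} (R : ∀ m, W.obj m → K.obj m → Prop)
    (hmap : ∀ {m m'} (f : m ⟶ m') x y, R m x y → R m' (W.map f x) (K.map f y))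
    (hex : ∀ m x, ∃ y, R m x y) (huniq : ∀ m x y y', R m x y → R m x y' → y = y') :
    ∃ f : W ⟶ K, ∀ m x, R m x (f.app m x) := by
  choose φ hφ using hex
  refine ⟨{ app := fun m ↦ ↾(φ m), naturality := fun m m' f ↦ ?_ }, fun m x ↦ hφ m x⟩
  ext x
  exact huniq _ _ _ _ (hφ _ _) (hmap f _ _ (hφ m x))

lemma KanComplex.exists_extension {X Y K : SSet.{u}} [KanComplex K] {i : X ⟶ Y}
    (hi : anodyneExtensions i) (f : X ⟶ K) : ∃ g : Y ⟶ K, i ≫ g = f := by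
  have : HasLiftingProperty i (Limits.terminal.from K) :=
    hi _ (by rw [← HomotopicalAlgebra.fibration_iff]; infer_instance)
  have sq : CommSq f i (Limits.terminal.from K) (Limits.terminal.from _) := ⟨by subsingleton⟩
  exact ⟨sq.lift, by simp⟩

/-- Extension of a partially defined map, given by a relation that is functional on a
subcomplex, along an anodyne inclusion. -/
lemma KanComplex.exists_extension_of_rel {W K : SSet.{u}} [KanComplex K] (U : W.Subcomplex)
    (hU : anodyneExtensions U.ι) (R : ∀ m, W.obj m → K.obj m → Prop)
    (hmap : ∀ {m m'} (f : m ⟶ m') x y, R m x y → R m' (W.map f x) (K.map f y))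
    (hex : ∀ m, ∀ x ∈ U.obj m, ∃ y, R m x y)
    (huniq : ∀ m x y y', R m x y → R m x y' → y = y') :
    ∃ f : W ⟶ K, ∀ m, ∀ x ∈ U.obj m, R m x (f.app m x) := by
  obtain ⟨g, hg⟩ := exists_hom_of_rel (W := (U : SSet)) (K := K) (fun m x y ↦ R m x.1 y)
    (fun f x y h ↦ hmap f x.1 y h) (fun m x ↦ hex m x.1 x.2) (fun m x ↦ huniq m x.1)
  obtain ⟨f, hf⟩ := exists_extension hU g
  refine ⟨f, fun m x hx ↦ ?_⟩
  have : f.app m x = g.app m ⟨x, hx⟩ := by rw [← hf]; rfl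
  rw [this]
  exact hg m ⟨x, hx⟩

/-! ### The interval, box filling and homotopy extension -/

/-- The `m`-simplex of `Δ[1]` which is constant with value `e`. -/
abbrev pt (e : Fin 2) (m : SimplexCategoryᵒᵖ) : (Δ[1] : SSet.{u}).obj m := stdSimplex.const 1 e m

lemma pt_injective {e e' : Fin 2} {m : SimplexCategoryᵒᵖ} (h : pt.{u} e m = pt e' m) : e = e' := by
  have := congrArg (fun x ↦ stdSimplex.asOrderHom x 0) h
  exact this

lemma mem_horn_one_iff (e : Fin 2) {m : SimplexCategoryᵒᵖ} (t : (Δ[1] : SSet.{u}).obj m) :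
    t ∈ (horn 1 e).obj m ↔ t = pt e m := by
  induction m using Opposite.rec with | _ m
  induction m using SimplexCategory.rec with | _ m
  rw [mem_horn_iff_notMem_range]
  constructor
  · rintro ⟨j, hj, hj'⟩
    ext i : 1
    change t i = e
    have : t i ≠ j := fun h ↦ hj' ⟨i, h⟩
    generalize t i = k at this ⊢
    clear hj'
    revert e j k
    decide
  · rintro rfl
    refine ⟨1 - e, by revert e; decide, ?_⟩
    rintro ⟨i, hi⟩
    change e = 1 - e at hi
    revert e
    decide

lemma mem_boundary_one_iff {m : SimplexCategoryᵒᵖ} (t : (Δ[1] : SSet.{u}).obj m) :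
    t ∈ (boundary 1).obj m ↔ ∃ e, t = pt e m := by
  induction m using Opposite.rec with | _ m
  induction m using SimplexCategory.rec with | _ m
  rw [mem_boundary_iff_notMem_range]
  constructor
  · rintro ⟨j, hj'⟩
    refine ⟨1 - j, ?_⟩
    ext i : 1
    change t i = 1 - j
    have : t i ≠ j := fun h ↦ hj' ⟨i, h⟩
    generalize t i = k at this ⊢
    clear hj'
    revert j k
    decide
  · rintro ⟨e, rfl⟩
    refine ⟨1 - e, ?_⟩
    rintro ⟨i, hi⟩
    change e = 1 - e at hi
    revert e
    decide

/-- Box filling: `B × □` with one side of the square missing (the one opposite to `F`),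
given on `A × □`. -/
lemma KanComplex.exists_box {B K : SSet.{u}} [KanComplex K] (A : B.Subcomplex) (e : Fin 2)
    (Γ : (B ⊗ Δ[1]) ⊗ Δ[1] ⟶ K) (S : Fin 2 → (B ⊗ Δ[1] ⟶ K)) (F : B ⊗ Δ[1] ⟶ K)
    (hS : ∀ m (b : B.obj m) i, (S i).app m (b, pt e m) = F.app m (b, pt i m))
    (hΓS : ∀ m, ∀ b ∈ A.obj m, ∀ i s, Γ.app m ((b, pt i m), s) = (S i).app m (b, s))
    (hΓF : ∀ m, ∀ b ∈ A.obj m, ∀ t, Γ.app m ((b, t), pt e m) = F.app m (b, t)) (e' : Fin 2) :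
    ∃ G : B ⊗ Δ[1] ⟶ K,
      (∀ m (b : B.obj m) i, G.app m (b, pt i m) = (S i).app m (b, pt e' m)) ∧
      ∀ m, ∀ b ∈ A.obj m, ∀ t, G.app m (b, t) = Γ.app m ((b, t), pt e' m) := by
  let R : ∀ m, ((B ⊗ Δ[1]) ⊗ Δ[1] : SSet).obj m → K.obj m → Prop := fun m x y ↦
      (x.1.1 ∈ A.obj m ∧ y = Γ.app m x) ∨
      (∃ i, x.1.2 = pt i m ∧ y = (S i).app m (x.1.1, x.2)) ∨
      (x.2 = pt e m ∧ y = F.app m x.1)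
  have huniq : ∀ m x y y', R m x y → R m x y' → y = y' := by
    rintro m ⟨⟨b, t⟩, s⟩ y y' h h'
    dsimp [R] at h h'
    rcases h with ⟨h, rfl⟩ | ⟨i, rfl, rfl⟩ | ⟨rfl, rfl⟩ <;>
    rcases h' with ⟨h', rfl⟩ | ⟨i', h', rfl⟩ | ⟨h', rfl⟩
    · rfl
    · subst h'
      exact hΓS _ _ h _ _
    · subst h'
      exact hΓF _ _ h _
    · exact (hΓS _ _ h' _ _).symm
    · rw [pt_injective h']
    · subst h'
      exact hS _ _ _
    · exact (hΓF _ _ h' _).symm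
    · subst h'
      exact (hS _ _ _).symm
    · rfl
  have hmap : ∀ {m m'} (f : m ⟶ m') x y,
      R m x y → R m' (((B ⊗ Δ[1]) ⊗ Δ[1]).map f x) (K.map f y) := by
    rintro m m' f ⟨⟨b, t⟩, s⟩ y h
    rcases h with ⟨h, rfl⟩ | ⟨i, h, rfl⟩ | ⟨h, rfl⟩
    · exact Or.inl ⟨A.map f h, (NatTrans.naturality_apply Γ f _).symm⟩
    · dsimp at h
      subst h
      exact Or.inr (Or.inl ⟨i, rfl, (NatTrans.naturality_apply (S i) f _).symm⟩)
    · dsimp at h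
      subst h
      exact Or.inr (Or.inr ⟨rfl, (NatTrans.naturality_apply F f _).symm⟩)
  have hex : ∀ m, ∀ x ∈ ((A.unionProd ∂Δ[1]).unionProd (horn 1 e)).obj m, ∃ y, R m x y := by
    rintro m ⟨⟨b, t⟩, s⟩ hx
    rcases (Subcomplex.mem_unionProd_iff _ _ _).1 hx with h | h
    · exact ⟨_, Or.inr (Or.inr ⟨(mem_horn_one_iff _ _).1 h, rfl⟩)⟩
    · rcases (Subcomplex.mem_unionProd_iff _ _ _).1 h with h | h
      · obtain ⟨i, hi⟩ := (mem_boundary_one_iff _).1 h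
        exact ⟨_, Or.inr (Or.inl ⟨i, hi, rfl⟩)⟩
      · exact ⟨_, Or.inl ⟨h, rfl⟩⟩
  obtain ⟨Φ, hΦ⟩ := KanComplex.exists_extension_of_rel (K := K)
    ((A.unionProd ∂Δ[1]).unionProd (horn 1 e))
    (anodyneExtensions_unionProd_ι _ _ (.horn_ι e)) R hmap hex huniq
  -- The filled box is restricted to the end `e'` of the last coordinate.
  let j : B ⊗ Δ[1] ⟶ (B ⊗ Δ[1]) ⊗ Δ[1] :=
    lift (𝟙 _) (const (stdSimplex.obj₀Equiv.symm e'))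
  have hj m (x : (B ⊗ Δ[1] : SSet).obj m) : (j ≫ Φ).app m x = Φ.app m (x, pt e' m) := rfl
  refine ⟨j ≫ Φ, fun m b i ↦ ?_, fun m b hb t ↦ ?_⟩
  · refine (hj m _).trans (huniq m ((b, pt i m), pt e' m) _ _ (hΦ m _ ?_)
      (Or.inr (Or.inl ⟨i, rfl, rfl⟩)))
    exact (Subcomplex.mem_unionProd_iff _ _ _).2 (Or.inr
      ((Subcomplex.mem_unionProd_iff _ _ _).2 (Or.inl ((mem_boundary_one_iff _).2 ⟨i, rfl⟩))))
  · refine (hj m _).trans (huniq m ((b, t), pt e' m) _ _ (hΦ m _ ?_) (Or.inl ⟨hb, rfl⟩))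
    exact (Subcomplex.mem_unionProd_iff _ _ _).2 (Or.inr
      ((Subcomplex.mem_unionProd_iff _ _ _).2 (Or.inr hb)))

/-- Homotopy extension property, from either end of the interval. -/
lemma KanComplex.exists_homotopyExtension {B K : SSet.{u}} [KanComplex K] (A : B.Subcomplex)
    (e : Fin 2) (f : B ⟶ K) (h : (A : SSet) ⊗ Δ[1] ⟶ K)
    (hf : ∀ m (a : (A : SSet).obj m), h.app m (a, pt e m) = f.app m a.1) :
    ∃ H : B ⊗ Δ[1] ⟶ K, (∀ m b, H.app m (b, pt e m) = f.app m b) ∧ A.ι ▷ _ ≫ H = h := by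
  obtain ⟨H, hH⟩ := KanComplex.exists_extension
    (anodyneExtensions_unionProd_ι A (horn 1 e) (.horn_ι e))
    ((Subcomplex.unionProd.isPushout A (horn 1 e)).desc (fst _ _ ≫ f) h (by
      ext m ⟨a, t, ht⟩
      rw [mem_horn_one_iff] at ht
      subst ht
      exact (hf m a).symm))
  refine ⟨H, fun m b ↦ ?_, ?_⟩
  · have : (Subcomplex.unionProd.ι₁ A (horn 1 e)) ≫ (A.unionProd (horn 1 e)).ι ≫ H =
        fst _ _ ≫ f := by
      rw [hH, IsPushout.inl_desc]
    exact ConcreteCategory.congr_hom (congr_app this m)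
      ((b, ⟨pt e m, (mem_horn_one_iff _ _).2 rfl⟩) : (B ⊗ (horn 1 e : SSet) : SSet).obj m)
  · rw [← Subcomplex.unionProd.ι₂_ι A (horn 1 e), Category.assoc, hH, IsPushout.inr_desc]

/-- Variant of the homotopy extension property where the homotopy on `A` is the restriction of
a homotopy on `B`. -/
lemma KanComplex.exists_homotopyExtension' {B K : SSet.{u}} [KanComplex K] (A : B.Subcomplex)
    (e : Fin 2) (f : B ⟶ K) (h : B ⊗ Δ[1] ⟶ K)
    (hf : ∀ m, ∀ a ∈ A.obj m, h.app m (a, pt e m) = f.app m a) :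
    ∃ H : B ⊗ Δ[1] ⟶ K, (∀ m b, H.app m (b, pt e m) = f.app m b) ∧
      ∀ m, ∀ a ∈ A.obj m, ∀ t, H.app m (a, t) = h.app m (a, t) := by
  obtain ⟨H, h₁, h₂⟩ := exists_homotopyExtension A e f (A.ι ▷ _ ≫ h) (fun m a ↦ hf m a.1 a.2)
  exact ⟨H, h₁, fun m a ha t ↦ ConcreteCategory.congr_hom (congr_app h₂ m)
    ((⟨a, ha⟩, t) : ((A : SSet) ⊗ Δ[1] : SSet).obj m)⟩

/-! ### Homotopy relative to a subcomplex -/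

/-- The relation of homotopy relative to a subcomplex. -/
def HtpyRel {B K : SSet.{u}} (A : B.Subcomplex) (f g : B ⟶ K) : Prop :=
  ∃ h : B ⊗ Δ[1] ⟶ K, (∀ m b, h.app m (b, pt 0 m) = f.app m b) ∧
    (∀ m b, h.app m (b, pt 1 m) = g.app m b) ∧
    ∀ m, ∀ a ∈ A.obj m, ∀ t, h.app m (a, t) = f.app m a

namespace HtpyRel

variable {B K : SSet.{u}} {A : B.Subcomplex} {f g k : B ⟶ K}

lemma eq_of_mem (h : HtpyRel A f g) {m} {a : B.obj m} (ha : a ∈ A.obj m) :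
    f.app m a = g.app m a := by
  obtain ⟨h, -, h₁, h₂⟩ := h
  rw [← h₁, h₂ _ _ ha]

variable (A f) in
lemma refl : HtpyRel A f f := ⟨fst _ _ ≫ f, fun _ _ ↦ rfl, fun _ _ ↦ rfl, fun _ _ _ _ ↦ rfl⟩

lemma postcomp (h : HtpyRel A f g) {K' : SSet.{u}} (p : K ⟶ K') : HtpyRel A (f ≫ p) (g ≫ p) := by
  obtain ⟨h, h₀, h₁, h₂⟩ := h
  exact ⟨h ≫ p, fun m b ↦ congrArg (p.app m) (h₀ m b), fun m b ↦ congrArg (p.app m) (h₁ m b),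
    fun m a ha t ↦ congrArg (p.app m) (h₂ m a ha t)⟩

/-- Transport of relative homotopies along homotopies that agree on the subcomplex. -/
lemma transport [KanComplex K] (H H' : B ⊗ Δ[1] ⟶ K)
    (hHH' : ∀ m, ∀ a ∈ A.obj m, ∀ t, H.app m (a, t) = H'.app m (a, t)) (e e' : Fin 2)
    {φ φ' ψ ψ' : B ⟶ K} (hφ : ∀ m b, H.app m (b, pt e m) = φ.app m b)
    (hφ' : ∀ m b, H'.app m (b, pt e m) = φ'.app m b)
    (hψ : ∀ m b, H.app m (b, pt e' m) = ψ.app m b)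
    (hψ' : ∀ m b, H'.app m (b, pt e' m) = ψ'.app m b)
    (h : HtpyRel A φ φ') : HtpyRel A ψ ψ' := by
  obtain ⟨F, h₀, h₁, h₂⟩ := h
  obtain ⟨G, hG, hG'⟩ := KanComplex.exists_box A e (fst B Δ[1] ▷ Δ[1] ≫ H) ![H, H'] F
    (fun m b i ↦ by
      fin_cases i
      · exact (hφ m b).trans (h₀ m b).symm
      · exact (hφ' m b).trans (h₁ m b).symm)
    (fun m b hb i s ↦ by
      fin_cases i
      · rfl
      · exact hHH' m b hb s)
    (fun m b hb t ↦ (hφ m b).trans (h₂ m b hb t).symm) e'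
  exact ⟨G, fun m b ↦ (hG m b 0).trans (hψ m b), fun m b ↦ (hG m b 1).trans (hψ' m b),
    fun m a ha t ↦ (hG' m a ha t).trans (hψ m a)⟩

lemma trans [KanComplex K] (h : HtpyRel A f g) (h' : HtpyRel A g k) : HtpyRel A f k := by
  have hgk := h'
  obtain ⟨H, h₀, h₁, h₂⟩ := h
  -- The homotopy from `g` to `k` is carried back along `H` from end 1 to end 0; the opposite side
  -- of the box is constant at `k`.
  refine transport H (fst _ _ ≫ k) (fun m a ha t ↦ ?_) 1 0 h₁ (fun _ _ ↦ rfl) h₀ (fun _ _ ↦ rfl) h'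
  rw [h₂ m a ha, ← h₀, h₂ m a ha, ← h₂ m a ha (pt 1 m), h₁, hgk.eq_of_mem ha]
  rfl

lemma symm [KanComplex K] (h : HtpyRel A f g) : HtpyRel A g f := by
  obtain ⟨H, h₀, h₁, h₂⟩ := h
  exact transport H (fst _ _ ≫ f) (fun m a ha t ↦ h₂ m a ha t) 0 1 h₀ (fun _ _ ↦ rfl) h₁
    (fun _ _ ↦ rfl) (refl A f)

variable (A) in
lemma equivalence [KanComplex K] : Equivalence (HtpyRel A (K := K)) :=
  ⟨refl A, symm, trans⟩

/-- Concatenation of a homotopy with a relative homotopy. -/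
lemma exists_concat [KanComplex K] (H : B ⊗ Δ[1] ⟶ K)
    (hf : ∀ m b, H.app m (b, pt 1 m) = f.app m b) (h : HtpyRel A f g) :
    ∃ H' : B ⊗ Δ[1] ⟶ K, (∀ m b, H'.app m (b, pt 0 m) = H.app m (b, pt 0 m)) ∧
      (∀ m b, H'.app m (b, pt 1 m) = g.app m b) ∧
      ∀ m, ∀ a ∈ A.obj m, ∀ t, H'.app m (a, t) = H.app m (a, t) := by
  obtain ⟨F, h₀, h₁, h₂⟩ := h
  obtain ⟨G, hG, hG'⟩ := KanComplex.exists_box A 0 (fst (B ⊗ Δ[1]) Δ[1] ≫ H)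
    ![fst B Δ[1] ≫ ι₀ ≫ H, F] H
    (fun m b i ↦ by
      fin_cases i
      · rfl
      · exact (h₀ m b).trans (hf m b).symm)
    (fun m b hb i s ↦ by
      fin_cases i
      · rfl
      · exact (hf m b).trans (h₂ m b hb s).symm)
    (fun m b hb t ↦ rfl) 1
  exact ⟨G, fun m b ↦ hG m b 0, fun m b ↦ (hG m b 1).trans (h₁ m b), hG'⟩

end HtpyRel

/-! ### Homotopy classes of maps and weak equivalences -/

lemma nonempty_homotopy_iff {X Z : SSet.{u}} (f g : X ⟶ Z) :
    Nonempty (SSet.Homotopy f g) ↔ HtpyRel ⊥ f g := by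
  constructor
  · rintro ⟨H⟩
    exact ⟨H.h, fun m b ↦ ConcreteCategory.congr_hom (congr_app H.h₀ m) b,
      fun m b ↦ ConcreteCategory.congr_hom (congr_app H.h₁ m) b, fun _ _ ha ↦ ha.elim⟩
  · rintro ⟨h, h₀, h₁, -⟩
    exact ⟨{
      h := h
      h₀ := by ext m b; exact h₀ m b
      h₁ := by ext m b; exact h₁ m b
      rel := by ext _ ⟨⟨x, hx⟩, _⟩; exact hx.elim }⟩

namespace MapClasses

/-- The homotopy class of a map. -/
def mk {X Z : SSet.{u}} (f : X ⟶ Z) : MapClasses X Z := Quot.mk _ f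

lemma mk_eq_of_htpyRel {X Z : SSet.{u}} {f g : X ⟶ Z} (h : HtpyRel ⊥ f g) : mk f = mk g :=
  Quot.sound ((nonempty_homotopy_iff _ _).2 h)

lemma mk_eq_iff {X Z : SSet.{u}} [KanComplex Z] (f g : X ⟶ Z) : mk f = mk g ↔ HtpyRel ⊥ f g := by
  refine ⟨fun h ↦ ?_, mk_eq_of_htpyRel⟩
  have h' := Quot.eqvGen_exact h
  rw [← (HtpyRel.equivalence (⊥ : X.Subcomplex) (K := Z)).eqvGen_iff]
  exact h'.mono fun _ _ ↦ (nonempty_homotopy_iff _ _).1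

/-- The map `[X, Z] → [X, Z']` given by postcomposition with `p : Z ⟶ Z'`. -/
def postcomp (X : SSet.{u}) {Z Z' : SSet.{u}} (p : Z ⟶ Z') : MapClasses X Z → MapClasses X Z' :=
  Quot.map (fun g ↦ g ≫ p) (fun f g h ↦ by
    rw [nonempty_homotopy_iff] at h ⊢
    exact h.postcomp p)

end MapClasses

/-- A homotopy between the restrictions of two maps along an anodyne extension extends. -/
lemma KanComplex.htpyRel_of_anodyneExtensions {X Y Z : SSet.{u}} [KanComplex Z] {i : X ⟶ Y}
    (hi : anodyneExtensions i) [Mono i] {f g : Y ⟶ Z} (h : HtpyRel ⊥ (i ≫ f) (i ≫ g)) :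
    HtpyRel ⊥ f g := by
  obtain ⟨h, h₀, h₁, -⟩ := h
  obtain ⟨H, hH⟩ := exists_extension (hi.whiskerRight Δ[1]) h
  have hA : anodyneExtensions (Subcomplex.range i).ι := by
    refine (anodyneExtensions.arrow_mk_iso_iff ?_).1 hi
    exact Arrow.isoMk (asIso (Subcomplex.toRange i)) (Iso.refl _)
  have hH' (m) (x : X.obj m) t : H.app m (i.app m x, t) = h.app m (x, t) :=
    ConcreteCategory.congr_hom (congr_app hH m) ((x, t) : (X ⊗ Δ[1] : SSet).obj m)
  -- The ends of `H` need not be `f` and `g`, so only its values over the range of `i` are kept.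
  -- They are glued with `f` and `g` on the two ends and extended again.
  let R : ∀ m, (Y ⊗ Δ[1] : SSet).obj m → Z.obj m → Prop := fun m x y ↦
      (x.1 ∈ Set.range (i.app m) ∧ y = H.app m x) ∨ (x.2 = pt 0 m ∧ y = f.app m x.1) ∨
        (x.2 = pt 1 m ∧ y = g.app m x.1)
  have huniq : ∀ m x y y', R m x y → R m x y' → y = y' := by
    rintro m ⟨b, t⟩ y y' h h'
    dsimp [R] at h h'
    have h01 : pt.{u} 0 m ≠ pt 1 m := fun h ↦ by simpa using pt_injective h
    rcases h with ⟨⟨x, rfl⟩, rfl⟩ | ⟨rfl, rfl⟩ | ⟨rfl, rfl⟩ <;>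
    rcases h' with ⟨⟨x', h'⟩, rfl⟩ | ⟨h', rfl⟩ | ⟨h', rfl⟩
    · rfl
    · subst h'
      exact (hH' _ _ _).trans (h₀ _ _)
    · subst h'
      exact (hH' _ _ _).trans (h₁ _ _)
    · subst h'
      exact ((hH' _ _ _).trans (h₀ _ _)).symm
    · rfl
    · exact (h01 h').elim
    · subst h'
      exact ((hH' _ _ _).trans (h₁ _ _)).symm
    · exact (h01 h'.symm).elim
    · rfl
  have hmap : ∀ {m m'} (φ : m ⟶ m') x y, R m x y → R m' ((Y ⊗ Δ[1]).map φ x) (Z.map φ y) := by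
    rintro m m' φ ⟨b, t⟩ y h
    rcases h with ⟨⟨x, hx⟩, rfl⟩ | ⟨h, rfl⟩ | ⟨h, rfl⟩
    · refine Or.inl ⟨⟨X.map φ x, ?_⟩, (NatTrans.naturality_apply H φ _).symm⟩
      rw [NatTrans.naturality_apply, hx]
      rfl
    · dsimp at h
      subst h
      exact Or.inr (Or.inl ⟨rfl, (NatTrans.naturality_apply f φ _).symm⟩)
    · dsimp at h
      subst h
      exact Or.inr (Or.inr ⟨rfl, (NatTrans.naturality_apply g φ _).symm⟩)
  have hex : ∀ m, ∀ x ∈ ((Subcomplex.range i).unionProd ∂Δ[1]).obj m, ∃ y, R m x y := by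
    rintro m ⟨b, t⟩ hx
    rcases (Subcomplex.mem_unionProd_iff _ _ _).1 hx with h | h
    · obtain ⟨e, he⟩ := (mem_boundary_one_iff _).1 h
      fin_cases e
      · exact ⟨_, Or.inr (Or.inl ⟨he, rfl⟩)⟩
      · exact ⟨_, Or.inr (Or.inr ⟨he, rfl⟩)⟩
    · exact ⟨_, Or.inl ⟨h, rfl⟩⟩
  obtain ⟨Φ, hΦ⟩ := KanComplex.exists_extension_of_rel (K := Z) _
    (anodyneExtensions_unionProd_ι' (Subcomplex.range i) ∂Δ[1] hA) R hmap hex huniq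
  have hmem (m) (b : Y.obj m) (e : Fin 2) :
      ((b, pt e m) : (Y ⊗ Δ[1] : SSet).obj m) ∈
        ((Subcomplex.range i).unionProd ∂Δ[1]).obj m :=
    (Subcomplex.mem_unionProd_iff _ _ _).2 (Or.inl ((mem_boundary_one_iff _).2 ⟨e, rfl⟩))
  exact ⟨Φ, fun m b ↦ huniq _ _ _ _ (hΦ m _ (hmem m b 0)) (Or.inr (Or.inl ⟨rfl, rfl⟩)),
    fun m b ↦ huniq _ _ _ _ (hΦ m _ (hmem m b 1)) (Or.inr (Or.inr ⟨rfl, rfl⟩)),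
    fun _ _ ha ↦ ha.elim⟩

/-- By the small object argument, anodyne extensions are retracts of transfinite compositions of
pushouts of coproducts of horn inclusions, and monomorphisms are stable under all these operations.
-/
lemma anodyneExtensions.mono {X Y : SSet.{u}} {i : X ⟶ Y} (hi : anodyneExtensions i) :
    Mono i := by
  rw [anodyneExtensions_eq_retracts_transfiniteCompositions] at hi
  have h₁ : (MorphismProperty.transfiniteCompositions.{u} (MorphismProperty.coproducts.{u}
      modelCategoryQuillen.J.{u}).pushouts) ≤ MorphismProperty.monomorphisms _ := by
    rw [MorphismProperty.transfiniteCompositions_le_iff, MorphismProperty.pushouts_le_iff,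
      MorphismProperty.coproducts_le_iff]
    exact modelCategoryQuillen.J_le_monomorphisms
  exact (MorphismProperty.retracts_le_iff.2 h₁) _ hi

/-- Extending maps gives surjectivity, extending homotopies gives injectivity. -/
lemma anodyneExtensions.isWeakEquivalence {X Y : SSet.{u}} {i : X ⟶ Y}
    (hi : anodyneExtensions i) : IsWeakEquivalence i := by
  intro Z _
  have := hi.mono
  constructor
  · rintro ⟨f⟩ ⟨g⟩ h
    exact MapClasses.mk_eq_of_htpyRel
      (KanComplex.htpyRel_of_anodyneExtensions hi ((MapClasses.mk_eq_iff _ _).1 h))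
  · rintro ⟨f⟩
    obtain ⟨g, rfl⟩ := KanComplex.exists_extension hi f
    exact ⟨MapClasses.mk g, rfl⟩

/-- The inclusion of a deformation retract is a weak equivalence. -/
lemma isWeakEquivalence_of_retraction {X Y : SSet.{u}} (i : X ⟶ Y) (r : Y ⟶ X)
    (hir : i ≫ r = 𝟙 X) (hri : HtpyRel ⊥ (𝟙 Y) (r ≫ i)) : IsWeakEquivalence i := by
  intro Z _
  refine Function.bijective_iff_has_inverse.2 ⟨MapClasses.precomp r Z, ?_, ?_⟩
  · rintro ⟨f⟩
    exact (MapClasses.mk_eq_of_htpyRel (hri.postcomp f)).symm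
  · rintro ⟨f⟩
    change MapClasses.mk (i ≫ r ≫ f) = MapClasses.mk f
    rw [reassoc_of% hir]

/-- The arrows of a zigzag cannot be composed, but the bijections they induce on homotopy classes
can be inverted and composed. Naturality in the Kan complex is what feeds the Yoneda argument below.
-/
lemma WeaklyEquivalent.exists_equiv {X Y : SSet.{u}} (h : WeaklyEquivalent X Y) :
    ∃ Φ : ∀ Z : SSet.{u}, KanComplex Z → (MapClasses X Z ≃ MapClasses Y Z),
      ∀ (Z Z' : SSet.{u}) (hZ : KanComplex Z) (hZ' : KanComplex Z') (p : Z ⟶ Z') x,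
        Φ Z' hZ' (MapClasses.postcomp X p x) = MapClasses.postcomp Y p (Φ Z hZ x) := by
  induction h with
  | rel X Y h =>
    obtain ⟨f, hf⟩ := h
    refine ⟨fun Z hZ ↦ (Equiv.ofBijective _ (hf Z hZ)).symm, fun Z Z' hZ hZ' p x ↦ ?_⟩
    obtain ⟨y, rfl⟩ := (hf Z hZ).2 x
    refine ((Equiv.symm_apply_eq _).2 ?_)
    dsimp only
    rw [Equiv.ofBijective_symm_apply_apply]
    obtain ⟨y⟩ := y
    rfl
  | refl X => exact ⟨fun Z hZ ↦ Equiv.refl _, fun _ _ _ _ _ _ ↦ rfl⟩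
  | symm X Y _ h =>
    obtain ⟨Φ, hΦ⟩ := h
    refine ⟨fun Z hZ ↦ (Φ Z hZ).symm, fun Z Z' hZ hZ' p x ↦ ?_⟩
    rw [Equiv.symm_apply_eq, hΦ _ _ hZ hZ', Equiv.apply_symm_apply]
  | trans X Y Z _ _ h h' =>
    obtain ⟨Φ, hΦ⟩ := h
    obtain ⟨Φ', hΦ'⟩ := h'
    refine ⟨fun Z hZ ↦ (Φ Z hZ).trans (Φ' Z hZ), fun Z Z' hZ hZ' p x ↦ ?_⟩
    dsimp
    rw [hΦ _ _ hZ hZ', hΦ' _ _ hZ hZ']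

/-- Yoneda: `g` represents the image of the identity of `K`, and `f` the preimage of the identity of
`L`. By naturality `f ≫ g` and `𝟙 K` have the same image under the bijection. -/
lemma WeaklyEquivalent.exists_homotopyRetract {K L : SSet.{u}} [KanComplex K] [KanComplex L]
    (h : WeaklyEquivalent K L) :
    ∃ (f : K ⟶ L) (g : L ⟶ K), HtpyRel ⊥ (𝟙 K) (f ≫ g) := by
  obtain ⟨Φ, hΦ⟩ := h.exists_equiv
  obtain ⟨g, hg⟩ := Quot.exists_rep (Φ K inferInstance (MapClasses.mk (𝟙 K)))
  obtain ⟨f, hf⟩ := Quot.exists_rep ((Φ L inferInstance).symm (MapClasses.mk (𝟙 L)))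
  refine ⟨f, g, ((MapClasses.mk_eq_iff _ _).1 ((Φ K inferInstance).injective ?_))⟩
  have h := hΦ L K inferInstance inferInstance g (MapClasses.mk f)
  rw [← hg]
  refine (h.trans ?_).symm
  change MapClasses.postcomp L g (Φ L _ (Quot.mk _ f)) = _
  rw [hf, Equiv.apply_symm_apply]
  change MapClasses.mk (𝟙 L ≫ g) = _
  rw [Category.id_comp]
  rfl

/-! ### Comparing simplices through homotopy groups -/

lemma RelativeMorphism.nonempty_homotopy_iff {X Y : SSet.{u}} {A : X.Subcomplex}
    {B : Y.Subcomplex} {φ : (A : SSet) ⟶ (B : SSet)} (f g : RelativeMorphism A B φ) :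
    Nonempty (f.Homotopy g) ↔ HtpyRel A f.map g.map := by
  constructor
  · rintro ⟨H⟩
    refine ⟨H.h, fun m b ↦ ConcreteCategory.congr_hom (congr_app H.h₀ m) b,
      fun m b ↦ ConcreteCategory.congr_hom (congr_app H.h₁ m) b, fun m a ha t ↦ ?_⟩
    have h : H.h.app m (a, t) = (φ.app m ⟨a, ha⟩).1 :=
      ConcreteCategory.congr_hom (congr_app H.rel m)
        ((⟨a, ha⟩, t) : ((A : SSet) ⊗ Δ[1] : SSet).obj m)
    rw [h, f.map_eq_of_mem a ha]
  · rintro ⟨h, h₀, h₁, h₂⟩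
    exact ⟨{
      h := h
      h₀ := by ext m b; exact h₀ m b
      h₁ := by ext m b; exact h₁ m b
      rel := by
        ext m ⟨⟨a, ha⟩, t⟩
        exact (h₂ m a ha t).trans (f.map_eq_of_mem a ha) }⟩

lemma RelativeMorphism.homotopyClass_eq_iff {X Y : SSet.{u}} [KanComplex Y] {A : X.Subcomplex}
    {B : Y.Subcomplex} {φ : (A : SSet) ⟶ (B : SSet)} (f g : RelativeMorphism A B φ) :
    f.homotopyClass = g.homotopyClass ↔ HtpyRel A f.map g.map := by
  refine ⟨fun h ↦ ?_, fun h ↦ Quot.sound ((nonempty_homotopy_iff _ _).2 h)⟩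
  have h' := Quot.eqvGen_exact h
  have he : Equivalence (fun f g : RelativeMorphism A B φ ↦ HtpyRel A f.map g.map) :=
    (HtpyRel.equivalence A (K := Y)).comap RelativeMorphism.map
  rw [← he.eqvGen_iff]
  exact h'.mono fun _ _ ↦ (nonempty_homotopy_iff _ _).1

/-- The homotopy from the identity of `Δ[n]` to the constant map with value the last vertex. -/
def contraction (n : ℕ) : (Δ[n] ⊗ Δ[1] : SSet.{u}) ⟶ Δ[n] where
  app m := ↾fun z ↦ stdSimplex.objMk
    { toFun k := if stdSimplex.asOrderHom z.2 k = 0 then stdSimplex.asOrderHom z.1 k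
        else Fin.last n
      monotone' k l hkl := by
        have h₁ := (stdSimplex.asOrderHom z.1).monotone hkl
        have h₂ := (stdSimplex.asOrderHom z.2).monotone hkl
        dsimp only
        split_ifs with h h' h'
        · exact h₁
        · exact Fin.le_last _
        · rw [h'] at h₂
          exact (h (le_antisymm h₂ (Fin.zero_le _))).elim
        · rfl }
  naturality _ _ _ := rfl

lemma htpyRel_const {K : SSet.{u}} {n : ℕ} (f : Δ[n] ⟶ K) :
    ∃ y : K _⦋0⦌, HtpyRel ⊥ f (const y) := by
  refine ⟨f.app _ (stdSimplex.const n (Fin.last n) _), contraction n ≫ f, fun m b ↦ ?_,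
    fun m b ↦ ?_, fun _ _ ha ↦ ha.elim⟩
  · change f.app m ((contraction n).app m (b, pt 0 m)) = f.app m b
    congr 1
    induction m using Opposite.rec with | _ m
    induction m using SimplexCategory.rec with | _ m
    ext k : 1
    rfl
  · change f.app m (stdSimplex.const n (Fin.last n) m) = K.map _ _
    rw [← NatTrans.naturality_apply]
    rfl

/-- The simplices with a given boundary inject, up to homotopy relative to the boundary, in a
homotopy group. -/
lemma KanComplex.exists_differenceClass {K : SSet.{u}} [KanComplex K] {n : ℕ} (x : K _⦋0⦌)
    (f₀ : Δ[n] ⟶ K) (h : HtpyRel ⊥ f₀ (const x)) :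
    ∃ Θ : {f : Δ[n] ⟶ K // ∀ m, ∀ a ∈ (boundary n).obj m, f.app m a = f₀.app m a} →
      SimplicialHomotopyGroup n K x, ∀ f g, Θ f = Θ g → HtpyRel (boundary n) f.1 g.1 := by
  obtain ⟨h, h₀, h₁, -⟩ := h
  -- All these simplices are dragged along the same homotopy of the boundary, so each ends at a
  -- simplex that is constant at `x` on the boundary.
  have hex (f : {f : Δ[n] ⟶ K // ∀ m, ∀ a ∈ (boundary n).obj m, f.app m a = f₀.app m a}) :=
    exists_homotopyExtension' (boundary n) 0 f.1 h
      (fun m a ha ↦ (h₀ m a).trans (f.2 m a ha).symm)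
  choose H hH₀ hH using hex
  refine ⟨fun f ↦ RelativeMorphism.homotopyClass
    { map := ι₁ ≫ H f
      comm := by
        ext m ⟨a, ha⟩
        exact (hH f m a ha _).trans (h₁ m a) }, fun f g hfg ↦ ?_⟩
  refine HtpyRel.transport (H f) (H g) (fun m a ha t ↦ (hH f m a ha t).trans (hH g m a ha t).symm)
    1 0 (fun _ _ ↦ rfl) (fun _ _ ↦ rfl) (hH₀ f) (hH₀ g)
    ((RelativeMorphism.homotopyClass_eq_iff _ _).1 hfg)

/-- If `K` is a homotopy retract of `L`, the homotopy groups of `K` inject in those of `L`. -/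
lemma SimplicialHomotopyGroup.exists_injective {K L : SSet.{u}} [KanComplex K] [KanComplex L]
    (f : K ⟶ L) (g : L ⟶ K) (h : HtpyRel ⊥ (𝟙 K) (f ≫ g)) (n : ℕ) (x : K _⦋0⦌) :
    ∃ Θ : SimplicialHomotopyGroup n K x → SimplicialHomotopyGroup n L (f.app _ x),
      Function.Injective Θ := by
  have hrep (c : SimplicialHomotopyGroup n K x) := Quot.exists_rep c
  choose r hr using hrep
  -- Only injectivity matters, so the map is defined on chosen representatives and need not be a
  -- homomorphism.
  refine ⟨fun c ↦ RelativeMorphism.homotopyClass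
    { map := (r c).map ≫ f
      comm := by
        rw [← Category.assoc, (r c).comm]
        ext m a
        exact NatTrans.naturality_apply f _ _ }, fun c d hcd ↦ ?_⟩
  have hcd' := ((RelativeMorphism.homotopyClass_eq_iff _ _).1 hcd).postcomp g
  obtain ⟨H, h₀, h₁, -⟩ := h
  rw [← hr c, ← hr d]
  -- The homotopy from `𝟙 K` to `f ≫ g` may move the base point, but it moves both representatives
  -- identically on the boundary.
  refine (RelativeMorphism.homotopyClass_eq_iff _ _).2 (HtpyRel.transport
    (φ := ((r c).map ≫ f) ≫ g) (φ' := ((r d).map ≫ f) ≫ g)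
    ((r c).map ▷ _ ≫ H) ((r d).map ▷ _ ≫ H) (fun m a ha t ↦ ?_) 1 0
    (fun m b ↦ h₁ m _) (fun m b ↦ h₁ m _) (fun m b ↦ h₀ m _) (fun m b ↦ h₀ m _) hcd')
  change H.app m ((r c).map.app m a, t) = H.app m ((r d).map.app m a, t)
  rw [(r c).map_eq_of_mem a ha, (r d).map_eq_of_mem a ha]

/-! ### Path components of a fibrant replacement -/

lemma htpyRel_const_of_edge {B K : SSet.{u}} (s : Δ[1] ⟶ K) :
    HtpyRel (⊥ : B.Subcomplex) (const (s.app _ (stdSimplex.const 1 0 _)))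
      (const (s.app _ (stdSimplex.const 1 1 _))) := by
  refine ⟨snd _ _ ≫ s, fun m b ↦ ?_, fun m b ↦ ?_, fun _ _ ha ↦ ha.elim⟩
  · change s.app m (stdSimplex.const 1 0 m) = K.map _ _
    rw [← NatTrans.naturality_apply]
    rfl
  · change s.app m (stdSimplex.const 1 1 m) = K.map _ _
    rw [← NatTrans.naturality_apply]
    rfl

lemma htpyRel_const_vertices {B K : SSet.{u}} [KanComplex K] {n : ℕ} (s : Δ[n] ⟶ K)
    (i j : Fin (n + 1)) :
    HtpyRel (⊥ : B.Subcomplex) (const (s.app _ (stdSimplex.const n i _)))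
      (const (s.app _ (stdSimplex.const n j _))) := by
  have key (i j : Fin (n + 1)) (hij : i ≤ j) :
      HtpyRel (⊥ : B.Subcomplex) (const (s.app _ (stdSimplex.const n i _)))
        (const (s.app _ (stdSimplex.const n j _))) := by
    have h := htpyRel_const_of_edge (B := B) (yonedaEquiv.symm (stdSimplex.edge n i j hij) ≫ s)
    have h₀ : (yonedaEquiv.symm (stdSimplex.edge n i j hij)).app _ (stdSimplex.const 1 0 _) =
        stdSimplex.const n i (op ⦋0⦌) := by
      ext k : 1
      rfl
    have h₁ : (yonedaEquiv.symm (stdSimplex.edge n i j hij)).app _ (stdSimplex.const 1 1 _) =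
        stdSimplex.const n j (op ⦋0⦌) := by
      ext k : 1
      rfl
    rw [← h₀, ← h₁]
    exact h
  rcases le_total i j with hij | hij
  · exact key i j hij
  · exact (key j i hij).symm

lemma const_mem_horn {n : ℕ} (i : Fin (n + 2)) (m : SimplexCategoryᵒᵖ) :
    stdSimplex.const (n + 1) i m ∈ (horn.{u} (n + 1) i).obj m := by
  rw [mem_horn_iff]
  intro h
  obtain ⟨j, hj⟩ := exists_ne i
  have := h.ge (Set.mem_univ j)
  simp only [Set.union_singleton, Set.mem_insert_iff, Set.mem_range] at this
  rcases this with h | ⟨k, hk⟩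
  · exact hj h
  · exact hj hk.symm

lemma const_vertex {K : SSet.{u}} {n : ℕ} (s : K _⦋n⦌) (φ : ⦋0⦌ ⟶ ⦋n⦌) :
    K.map φ.op s = (yonedaEquiv.symm s).app _ (stdSimplex.const n (φ 0) _) := by
  have h : φ = stdSimplex.objEquiv (stdSimplex.const.{u} n (φ 0) (op ⦋0⦌)) := by
    ext i : 3
    fin_cases i
    rfl
  nth_rw 1 [h]
  rfl

/-- An anodyne extension with values in a Kan complex meets every path component. -/
lemma anodyneExtensions.exists_htpyRel_const {X K : SSet.{u}} [KanComplex K] {i : X ⟶ K}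
    (hi : anodyneExtensions i) (B : SSet.{u}) (y : K _⦋0⦌) :
    ∃ x : X _⦋0⦌, HtpyRel (⊥ : B.Subcomplex) (const y) (const (i.app _ x)) := by
  -- `K'` consists of the simplices whose vertices all lie in components met by `X`. A horn contains
  -- a vertex, and all vertices of a simplex lie in one component, so `K'.ι` lifts against horn
  -- inclusions. Hence `i` lifts against `K'.ι`, which forces `K'` to be all of `K`.
  let K' : K.Subcomplex :=
    { obj m := {s | ∀ φ : ⦋0⦌ ⟶ m.unop, ∃ x : X _⦋0⦌,
        HtpyRel (⊥ : B.Subcomplex) (const (K.map φ.op s)) (const (i.app _ x))}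
      map := fun f s hs φ ↦ by
        have := hs (φ ≫ f.unop)
        simpa using this }
  have hK' : modelCategoryQuillen.J.rlp K'.ι := by
    intro _ _ _ h
    simp only [modelCategoryQuillen.J, MorphismProperty.iSup_iff] at h
    obtain ⟨n, ⟨k⟩⟩ := h
    refine ⟨fun {t b} sq ↦ ?_⟩
    have hb : Subcomplex.range b ≤ K' := by
      rw [Subcomplex.range_eq_ofSimplex, Subcomplex.ofSimplex_le_iff]
      intro φ
      let v : (Λ[n + 1, k] : SSet.{u}) _⦋0⦌ := ⟨stdSimplex.const (n + 1) k _, const_mem_horn k _⟩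
      obtain ⟨x, hx⟩ := (t.app _ v).2 (𝟙 _)
      refine ⟨x, HtpyRel.trans ?_ hx⟩
      have h₁ : K.map (𝟙 ⦋0⦌).op (t.app _ v).1 = b.app _ (stdSimplex.const (n + 1) k _) := by
        have := ConcreteCategory.congr_hom (congr_app sq.w (op ⦋0⦌)) v
        simpa using! this
      rw [h₁]
      have := const_vertex (yonedaEquiv b) φ
      rw [Equiv.symm_apply_apply] at this
      change HtpyRel _ (const (K.map φ.op (yonedaEquiv b))) _
      rw [this]
      exact htpyRel_const_vertices _ _ _
    exact ⟨⟨{ l := Subcomplex.lift b hb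
              fac_left := by
                rw [← cancel_mono K'.ι, Category.assoc, Subcomplex.lift_ι, sq.w]
              fac_right := rfl }⟩⟩
  have : HasLiftingProperty i K'.ι := hi _ hK'
  have hiK' : Subcomplex.range i ≤ K' := by
    rintro m _ ⟨s, rfl⟩ φ
    exact ⟨X.map φ.op s, by rw [NatTrans.naturality_apply]; exact HtpyRel.refl _ _⟩
  have sq : CommSq (Subcomplex.lift i hiK') i K'.ι (𝟙 K) := ⟨by simp⟩
  have hy : y ∈ K'.obj (op ⦋0⦌) := by
    have := ConcreteCategory.congr_hom (congr_app sq.fac_right (op ⦋0⦌)) y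
    have h := (sq.lift.app _ y).2
    rwa [show (sq.lift.app _ y).1 = y from this] at h
  obtain ⟨x, hx⟩ := hy (𝟙 _)
  exact ⟨x, by simpa using hx⟩

/-! ### Minimal subcomplexes -/

/-- Degenerate simplices with the same faces are equal. -/
lemma eq_of_mem_degenerate {X : SSet.{u}} {n : ℕ} {a b : X _⦋n + 1⦌}
    (ha : a ∈ X.degenerate (n + 1)) (hb : b ∈ X.degenerate (n + 1))
    (h : ∀ i, X.δ i a = X.δ i b) : a = b := by
  rw [degenerate_eq_iUnion_range_σ, Set.mem_iUnion] at ha hb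
  obtain ⟨i, x, rfl⟩ := ha
  obtain ⟨j, y, rfl⟩ := hb
  wlog hij : i ≤ j generalizing i j x y
  · exact (this j y i x (fun k ↦ (h k).symm) (le_of_not_ge hij)).symm
  obtain rfl | hij := hij.eq_or_lt
  · have := h i.castSucc
    rw [δ_comp_σ_self_apply, δ_comp_σ_self_apply] at this
    rw [this]
  obtain _ | n := n
  · omega
  obtain ⟨i, rfl⟩ := Fin.eq_castSucc_of_ne_last (Fin.ne_last_of_lt hij)
  obtain ⟨j, rfl⟩ := Fin.eq_succ_of_ne_zero (Fin.ne_zero_of_lt hij)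
  -- Put z = `X.δ j.succ x`. Comparing the faces that cancel the degeneracy of `y` expresses `y` as
  -- a degeneracy of z. After exchanging degeneracies, comparing the faces that cancel the
  -- degeneracy of `x` gives `x = X.σ j z`.
  have hy : y = X.σ i (X.δ j.succ x) := by
    rw [← δ_comp_σ_of_gt_apply hij, h, δ_comp_σ_succ_apply]
  have hb : X.σ j.succ y = X.σ i.castSucc (X.σ j (X.δ j.succ x)) := by
    rw [hy, σ_comp_σ_apply (Fin.castSucc_lt_succ_iff.1 hij), ← hy]
  have hx : x = X.σ j (X.δ j.succ x) := by
    have := h i.castSucc.castSucc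
    rwa [hb, δ_comp_σ_self_apply, δ_comp_σ_self_apply] at this
  rw [hb, ← hx]

lemma HtpyRel.map_eq {K : SSet.{u}} {n : ℕ} {x y : K _⦋n⦌}
    (h : HtpyRel (boundary n) (yonedaEquiv.symm x) (yonedaEquiv.symm y))
    {k : ℕ} (φ : ⦋k⦌ ⟶ ⦋n⦌) (hφ : ¬ Function.Surjective φ) : K.map φ.op x = K.map φ.op y :=
  h.eq_of_mem (a := stdSimplex.objEquiv.symm φ) hφ

lemma not_surjective_δ {n : ℕ} (i : Fin (n + 2)) :
    ¬ Function.Surjective (SimplexCategory.δ i : ⦋n⦌ ⟶ ⦋n + 1⦌) := by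
  intro h
  obtain ⟨j, hj⟩ := h i
  exact Fin.succAbove_ne i j hj

lemma HtpyRel.δ_eq {K : SSet.{u}} {n : ℕ} {x y : K _⦋n + 1⦌}
    (h : HtpyRel (boundary (n + 1)) (yonedaEquiv.symm x) (yonedaEquiv.symm y)) (i : Fin (n + 2)) :
    K.δ i x = K.δ i y :=
  h.map_eq _ (not_surjective_δ i)

namespace Subcomplex

variable {K : SSet.{u}}

/-- A subcomplex is minimal if two of its simplices that are homotopic relative to their boundary
in the ambient simplicial set are equal. -/
def IsMinimal (L : K.Subcomplex) : Prop :=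
  ∀ ⦃n : ℕ⦄ ⦃x y : K _⦋n⦌⦄, x ∈ L.obj _ → y ∈ L.obj _ →
    HtpyRel (boundary n) (yonedaEquiv.symm x) (yonedaEquiv.symm y) → x = y

/-- Zorn's lemma applies because minimality involves two simplices at a time, and two simplices of
the union of a chain lie in a common member. -/
lemma exists_maximal_isMinimal (K : SSet.{u}) :
    ∃ L : K.Subcomplex, Maximal (fun L ↦ L ∈ {L | L.IsMinimal}) L := by
  refine zorn_le₀ _ (fun c hc hchain ↦ ⟨sSup c, fun n x y hx hy h ↦ ?_, fun _ h ↦ le_sSup h⟩)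
  obtain ⟨_, ⟨A, hA, rfl⟩, hx⟩ := hx
  obtain ⟨_, ⟨B, hB, rfl⟩, hy⟩ := hy
  rcases hchain.total hA hB with hAB | hAB
  · exact hc hB (hAB _ hx) hy h
  · exact hc hA hx (hAB _ hy) h

/-- Every simplex whose boundary lies in `L` is homotopic relative to its boundary to a simplex
of `L`. -/
def IsCompressing (L : K.Subcomplex) : Prop :=
  ∀ ⦃n : ℕ⦄ (x : K _⦋n⦌), boundary n ≤ L.preimage (yonedaEquiv.symm x) →
    ∃ y ∈ L.obj _, HtpyRel (boundary n) (yonedaEquiv.symm x) (yonedaEquiv.symm y)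

/-- If `x` were a counterexample, adjoining it to `L` would preserve minimality and contradict
maximality. The only new simplices are `x` and its degeneracies, because the boundary of `x` is in
`L`. -/
lemma isCompressing_of_maximal [KanComplex K] {L : K.Subcomplex}
    (hL : Maximal (fun L ↦ L ∈ {L | L.IsMinimal}) L) : L.IsCompressing := by
  intro n x hx
  by_contra! hxL
  have hmem {k : ℕ} {a : K _⦋k⦌} (ha : a ∈ (L ⊔ ofSimplex x).obj _) (haL : a ∉ L.obj _) :
      ∃ φ : ⦋k⦌ ⟶ ⦋n⦌, Epi φ ∧ a = K.map φ.op x := by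
    rcases ha with ha | ha
    · exact (haL ha).elim
    · obtain ⟨φ, rfl⟩ := (mem_ofSimplex_obj_iff _ _).1 ha
      refine ⟨φ, ?_, rfl⟩
      by_contra hφ
      rw [SimplexCategory.epi_iff_surjective] at hφ
      exact haL (hx _ (show stdSimplex.objEquiv.symm φ ∈ _ from hφ))
  have key {k : ℕ} {a b : K _⦋k⦌} (ha : a ∈ (L ⊔ ofSimplex x).obj _)
      (hb : b ∈ (L ⊔ ofSimplex x).obj _) (haL : a ∉ L.obj _)
      (hab : HtpyRel (boundary k) (yonedaEquiv.symm a) (yonedaEquiv.symm b)) : a = b := by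
    obtain ⟨φ, hφ, rfl⟩ := hmem ha haL
    obtain hk | rfl := (SimplexCategory.len_le_of_epi φ).lt_or_eq
    · dsimp at hk
      have hdeg : K.map φ.op x ∈ K.degenerate k := ⟨n, hk, φ, x, rfl⟩
      obtain _ | k := k
      · omega
      -- If `b` were in `L`, then `a`, being a degeneracy of a face it shares with `b`, would be in
      -- `L` too.
      have hbL : b ∉ L.obj _ := fun hbL ↦ by
        rw [degenerate_eq_iUnion_range_σ, Set.mem_iUnion] at hdeg
        obtain ⟨i, c, hc⟩ := hdeg
        have hc' : c = K.δ i.castSucc b := by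
          rw [← hab.δ_eq, ← hc, δ_comp_σ_self_apply]
        rw [← hc, hc'] at haL
        exact haL (L.map _ (L.map _ hbL))
      obtain ⟨ψ, hψ, rfl⟩ := hmem hb hbL
      exact eq_of_mem_degenerate hdeg ⟨n, hk, ψ, x, rfl⟩ hab.δ_eq
    · obtain rfl := SimplexCategory.eq_id_of_epi φ
      by_cases hbL : b ∈ L.obj _
      · exact (hxL b hbL (by simpa using hab)).elim
      · obtain ⟨ψ, hψ, rfl⟩ := hmem hb hbL
        obtain rfl := SimplexCategory.eq_id_of_epi ψ
        rfl
  have hmin : (L ⊔ ofSimplex x).IsMinimal := by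
    intro k a b ha hb hab
    by_cases haL : a ∈ L.obj _
    · by_cases hbL : b ∈ L.obj _
      · exact hL.1 haL hbL hab
      · exact (key hb ha hbL hab.symm).symm
    · exact key ha hb haL hab
  exact hxL x (hL.2 hmin le_sup_left _ (Or.inr (mem_ofSimplex_obj x))) (HtpyRel.refl _ _)

end Subcomplex

/-! ### Deformation retraction onto a compressing subcomplex -/

/-- Evaluation of paths at an end of the interval. -/
def pathEval (K : SSet.{u}) (e : Fin 2) : (ihom Δ[1]).obj K ⟶ K :=
  lift (const (stdSimplex.obj₀Equiv.symm e)) (𝟙 _) ≫ (ihom.ev Δ[1]).app K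

lemma pathEval_app {K Y : SSet.{u}} (g : Y ⟶ (ihom Δ[1]).obj K) (e : Fin 2)
    {m : SimplexCategoryᵒᵖ} (y : Y.obj m) :
    (pathEval K e).app m (g.app m y) = (MonoidalClosed.uncurry g).app m (pt e m, y) := by
  rw [MonoidalClosed.uncurry_eq]
  rfl

/-- The starting-point map on paths ending in `L` is a trivial fibration. To lift a simplex, extend
the homotopy given on its boundary, compress the end into `L` relative to the boundary, and
concatenate. -/
lemma Subcomplex.IsCompressing.rlp_I {K : SSet.{u}} [KanComplex K] {L : K.Subcomplex}
    (hL : L.IsCompressing) :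
    modelCategoryQuillen.I.rlp ((L.preimage (pathEval K 1)).ι ≫ pathEval K 0) := by
  rintro _ _ _ ⟨n⟩
  refine ⟨fun {t b} sq ↦ ?_⟩
  let g : (boundary n : SSet) ⟶ (ihom Δ[1]).obj K := t ≫ (L.preimage (pathEval K 1)).ι
  let h : (boundary n : SSet) ⊗ Δ[1] ⟶ K := (β_ _ _).hom ≫ MonoidalClosed.uncurry g
  have hh m (a : (boundary n : SSet).obj m) (e : Fin 2) :
      h.app m (a, pt e m) = (pathEval K e).app m (g.app m a) := (pathEval_app g e a).symm
  obtain ⟨H, hH₀, hH⟩ := KanComplex.exists_homotopyExtension (boundary n) 0 b h (fun m a ↦ by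
    rw [hh]
    exact ConcreteCategory.congr_hom (congr_app sq.w m) a)
  have hH' m (a : (boundary n : SSet).obj m) t : H.app m (a.1, t) = h.app m (a, t) :=
    ConcreteCategory.congr_hom (congr_app hH m) ((a, t) : ((boundary n : SSet) ⊗ Δ[1] : SSet).obj m)
  obtain ⟨y, hyL, hy⟩ := hL (yonedaEquiv (ι₁ ≫ H)) (fun m a ha ↦ by
    rw [Equiv.symm_apply_apply]
    change H.app m (a, pt 1 m) ∈ L.obj m
    rw [hH' m ⟨a, ha⟩]
    exact (hh m ⟨a, ha⟩ 1).symm ▸ (t.app m ⟨a, ha⟩).2)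
  rw [Equiv.symm_apply_apply] at hy
  obtain ⟨H', hH'₀, hH'₁, hH'A⟩ := HtpyRel.exists_concat H (fun _ _ ↦ rfl) hy
  let l : Δ[n] ⟶ (ihom Δ[1]).obj K := MonoidalClosed.curry ((β_ _ _).hom ≫ H')
  have hl m (a : Δ[n].obj m) (e : Fin 2) :
      (pathEval K e).app m (l.app m a) = H'.app m (a, pt e m) := by
    rw [pathEval_app, MonoidalClosed.uncurry_curry]
    rfl
  refine ⟨⟨{ l := Subcomplex.lift l ?_, fac_left := ?_, fac_right := ?_ }⟩⟩
  · rintro m _ ⟨a, rfl⟩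
    change (pathEval K 1).app m _ ∈ L.obj m
    rw [hl, hH'₁]
    exact L.map _ hyL
  · rw [← cancel_mono (L.preimage (pathEval K 1)).ι, Category.assoc]
    change (boundary n).ι ≫ l = g
    apply MonoidalClosed.uncurry_injective
    rw [MonoidalClosed.uncurry_natural_left, MonoidalClosed.uncurry_curry]
    ext m ⟨s, a⟩
    exact (hH'A m a.1 a.2 s).trans (hH' m a s)
  · ext m a
    exact (hl m a 0).trans ((hH'₀ m a).trans (hH₀ m a))

/-- A compressing subcomplex of a Kan complex is a deformation retract. -/
lemma Subcomplex.IsCompressing.exists_retraction {K : SSet.{u}} [KanComplex K]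
    {L : K.Subcomplex} (hL : L.IsCompressing) :
    ∃ r : K ⟶ L, L.ι ≫ r = 𝟙 _ ∧ HtpyRel ⊥ (𝟙 K) (r ≫ L.ι) := by
  have hp := hL.rlp_I
  rw [← rlp_monomorphisms] at hp
  have := hp L.ι inferInstance
  let c : (L : SSet) ⟶ (ihom Δ[1]).obj K := MonoidalClosed.curry (snd _ _ ≫ L.ι)
  have hc m (a : (L : SSet).obj m) (e : Fin 2) : (pathEval K e).app m (c.app m a) = a.1 := by
    rw [pathEval_app, MonoidalClosed.uncurry_curry]
    rfl
  -- Constant paths solve the lifting problem on `L`. A lift to `K` chooses paths into `L`, whose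
  -- endpoints define the retraction.
  have sq : CommSq (Subcomplex.lift c (B := L.preimage (pathEval K 1)) (by
      rintro m _ ⟨a, rfl⟩
      change (pathEval K 1).app m _ ∈ L.obj m
      rw [hc]
      exact a.2)) L.ι ((L.preimage (pathEval K 1)).ι ≫ pathEval K 0) (𝟙 K) := ⟨by
    ext m a
    exact hc m a 0⟩
  let ℓ : K ⟶ (ihom Δ[1]).obj K := sq.lift ≫ (L.preimage (pathEval K 1)).ι
  have hℓ : L.ι ≫ ℓ = c := by rw [← Category.assoc, sq.fac_left]; rfl
  refine ⟨Subcomplex.lift (ℓ ≫ pathEval K 1) ?_, ?_, (β_ _ _).hom ≫ MonoidalClosed.uncurry ℓ,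
    fun m b ↦ ?_, fun m b ↦ ?_, fun _ _ ha ↦ ha.elim⟩
  · rintro m _ ⟨a, rfl⟩
    exact (sq.lift.app m a).2
  · rw [← cancel_mono L.ι, Category.assoc]
    change L.ι ≫ ℓ ≫ pathEval K 1 = _
    rw [← Category.assoc, hℓ]
    ext m a
    exact hc m a 1
  · exact (pathEval_app ℓ 0 b).symm.trans
      (ConcreteCategory.congr_hom (congr_app sq.fac_right m) b)
  · exact (pathEval_app ℓ 1 b).symm

lemma KanComplex.of_retract {K L : SSet.{u}} [KanComplex K] (i : L ⟶ K) (r : K ⟶ L)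
    (hir : i ≫ r = 𝟙 L) : KanComplex L := by
  rw [KanComplex.iff]
  intro n k f hf
  obtain ⟨φ, hφ⟩ := KanComplex.hornFilling (hf.desc ≫ i)
  refine ⟨φ ≫ r, fun j hj ↦ ?_⟩
  rw [← horn.ι_ι k j hj, Category.assoc, ← Category.assoc _ φ r, ← hφ, Category.assoc, hir,
    Category.comp_id, horn.IsCompatible.ι_desc]

/-! ### Coskeletality from determination by faces -/

/-- If, in a Kan complex, two simplices of dimension `> N` or `= N` with the same faces are equal,
a compatible family of faces of a simplex of dimension `> N` has a unique filler. -/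
lemma KanComplex.exists_of_faces {L : SSet.{u}} [KanComplex L] {n : ℕ}
    (hL : ∀ a b : L _⦋n + 1⦌, (∀ i, L.δ i a = L.δ i b) → a = b)
    (y : Fin (n + 3) → L _⦋n + 1⦌)
    (hy : ∀ (i j : Fin (n + 2)), i ≤ j → L.δ i (y j.succ) = L.δ j (y i.castSucc)) :
    ∃ l : L _⦋n + 2⦌, ∀ i, L.δ i l = y i := by
  have hc : horn.IsCompatible (i := (0 : Fin (n + 3)))
      (fun j _ ↦ yonedaEquiv.symm (y j)) := by
    rw [horn.isCompatible_iff]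
    intro j k hj hk hjk
    rw [stdSimplex.δ_comp_yonedaEquiv_symm, stdSimplex.δ_comp_yonedaEquiv_symm]
    obtain ⟨k, rfl⟩ := Fin.eq_succ_of_ne_zero hk
    obtain ⟨j, rfl⟩ := Fin.eq_castSucc_of_ne_last (Fin.ne_last_of_lt hjk)
    have := hy j k (Fin.castSucc_lt_succ_iff.1 hjk)
    simpa using! congrArg yonedaEquiv.symm this.symm
  obtain ⟨φ, hφ⟩ := hc.exists_lift_of_kanComplex
  have hφ' (j : Fin (n + 3)) (hj : j ≠ 0) : L.δ j (yonedaEquiv φ) = y j := by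
    rw [← stdSimplex.yonedaEquiv_δ_comp, hφ j hj, Equiv.apply_symm_apply]
  refine ⟨yonedaEquiv φ, fun i ↦ ?_⟩
  -- The face 0 is missing from the horn; in the filler it has the same faces as `y 0`, so `hL`
  -- identifies them.
  by_cases hi : i = 0
  · subst hi
    refine hL _ _ fun i ↦ ?_
    have h := hy 0 i (Fin.zero_le _)
    rw [← hφ' i.succ (Fin.succ_ne_zero _)] at h
    exact (δ_comp_δ_apply (Fin.zero_le i) (yonedaEquiv φ)).symm.trans h
  · exact hφ' i hi

/-- The relation between the simplices `y` of `Y` and the simplices `l` of `L` given by a morphism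
`g` between the truncations: `g` sends the restrictions of `y` to those of `l`. -/
def TruncationRel {Y L : SSet.{u}} {N : ℕ} (g : (SimplexCategory.Truncated.inclusion N).op ⋙ Y ⟶
    (SimplexCategory.Truncated.inclusion N).op ⋙ L) (m : SimplexCategoryᵒᵖ)
    (y : Y.obj m) (l : L.obj m) : Prop :=
  ∀ (j : SimplexCategory) (hj : j.len ≤ N) (α : j ⟶ m.unop),
    L.map α.op l = g.app (op ⟨j, hj⟩) (Y.map α.op y)

namespace TruncationRel

variable {Y L : SSet.{u}} {N : ℕ} {g : (SimplexCategory.Truncated.inclusion N).op ⋙ Y ⟶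
    (SimplexCategory.Truncated.inclusion N).op ⋙ L}

lemma map {m m' : SimplexCategoryᵒᵖ} (f : m ⟶ m') {y : Y.obj m} {l : L.obj m}
    (h : TruncationRel g m y l) : TruncationRel g m' (Y.map f y) (L.map f l) := by
  intro j hj α
  have := h j hj (α ≫ f.unop)
  simpa using this

lemma app {k : SimplexCategory} (hk : k.len ≤ N) (y : Y.obj (op k)) :
    TruncationRel g (op k) y (g.app (op ⟨k, hk⟩) y) := by
  intro j hj α
  exact (NatTrans.naturality_apply g
    (SimplexCategory.Truncated.Hom.tr α hj hk).op y).symm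

lemma eq_app {k : SimplexCategory} (hk : k.len ≤ N) {y : Y.obj (op k)} {l : L.obj (op k)}
    (h : TruncationRel g (op k) y l) : l = g.app (op ⟨k, hk⟩) y := by
  simpa using! h k hk (𝟙 k)

lemma unique (hL : ∀ n, N ≤ n + 1 → ∀ a b : L _⦋n + 1⦌, (∀ i, L.δ i a = L.δ i b) → a = b)
    (k : ℕ) (y : Y _⦋k⦌) (l l' : L _⦋k⦌) (h : TruncationRel g _ y l)
    (h' : TruncationRel g _ y l') : l = l' := by
  induction k with
  | zero => exact (h.eq_app (Nat.zero_le _)).trans (h'.eq_app (Nat.zero_le _)).symm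
  | succ k hk =>
    by_cases hkN : k + 1 ≤ N
    · exact (h.eq_app hkN).trans (h'.eq_app hkN).symm
    · exact hL k (by lia) _ _ fun i ↦ hk _ _ _ (h.map _) (h'.map _)

lemma exists_rel [KanComplex L] (hN : N ≠ 0)
    (hL : ∀ n, N ≤ n + 1 → ∀ a b : L _⦋n + 1⦌, (∀ i, L.δ i a = L.δ i b) → a = b)
    (k : ℕ) (y : Y _⦋k⦌) : ∃ l, TruncationRel g _ y l := by
  induction k with
  | zero => exact ⟨_, app (Nat.zero_le _) y⟩
  | succ k hk =>
    by_cases hkN : k + 1 ≤ N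
    · exact ⟨_, app hkN y⟩
    -- Edges above the truncation level would occur only for `N = 0`. There existence can fail: a
    -- discrete set with two points has no edge between them.
    obtain _ | n := k
    · lia
    choose l hl using fun i ↦ hk (Y.δ i y)
    obtain ⟨z, hz⟩ := KanComplex.exists_of_faces (hL n (by lia)) l (fun i j hij ↦ by
      refine unique (g := g) hL _ (Y.δ i (Y.δ j.succ y)) _ _ ((hl _).map _) ?_
      rw [δ_comp_δ_apply hij]
      exact (hl _).map _)
    refine ⟨z, fun j hj α ↦ ?_⟩
    -- Since `j.len ≤ N < n + 2`, the operator `α` factors through a face, where the relation is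
    -- known.
    obtain ⟨i, β, rfl⟩ := SimplexCategory.eq_comp_δ_of_not_surjective α (fun hα ↦ by
      have := SimplexCategory.epi_iff_surjective.2 hα
      have := SimplexCategory.len_le_of_epi α
      dsimp at this
      lia)
    have := hl i j hj β
    rw [← hz] at this
    simpa [SimplicialObject.δ] using this

end TruncationRel

/-- A Kan complex in which simplices of dimension `≥ N` are determined by their faces
is `N`-coskeletal. -/
lemma KanComplex.isCoskeletal {L : SSet.{u}} [KanComplex L] (N : ℕ)
    (hL : ∀ n, N ≤ n + 1 → ∀ a b : L _⦋n + 1⦌, (∀ i, L.δ i a = L.δ i b) → a = b)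
    (hN : N ≠ 0) :
    SimplicialObject.IsCoskeletal L N := by
  refine ⟨⟨⟨Limits.IsTerminal.ofUniqueHom (fun E ↦ ?_) ?_⟩⟩⟩
  · have h := exists_hom_of_rel (TruncationRel E.hom) (fun f _ _ h ↦ h.map f)
      (fun m y ↦ TruncationRel.exists_rel hN hL m.unop.len y)
      (fun m y l l' ↦ TruncationRel.unique hL m.unop.len y l l')
    refine CostructuredArrow.homMk h.choose ?_
    ext ⟨m⟩ y
    exact (h.choose_spec (op m.1) y).eq_app m.2
  · intro E f
    ext : 1
    ext m y
    have key (f : E ⟶ Functor.RightExtension.mk L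
        (𝟙 ((SimplexCategory.Truncated.inclusion N).op ⋙ L))) :
        TruncationRel E.hom m y (f.left.app m y) := by
      intro j hj α
      refine (NatTrans.naturality_apply f.left α.op y).symm.trans ?_
      exact ConcreteCategory.congr_hom
        (congr_app (CostructuredArrow.w f) (op ⟨j, hj⟩)) (E.left.map α.op y)
    exact TruncationRel.unique hL m.unop.len y _ _ (key _) (key _)

/-- In dimensions at most `N < n`, every simplex of `Δ[n]` lies in the boundary, so the two maps
have the same truncation. -/
lemma IsCoskeletal.eq_of_eq_on_boundary {L : SSet.{u}} (N : ℕ)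
    [SimplicialObject.IsCoskeletal L N] {n : ℕ} (hn : N < n) (f g : Δ[n] ⟶ L)
    (h : ∀ m, ∀ a ∈ (boundary n).obj m, f.app m a = g.app m a) : f = g := by
  refine (L.hom_ext_of_isRightKanExtension
    (𝟙 ((SimplexCategory.Truncated.inclusion N).op ⋙ L)) f g ?_)
  ext ⟨m⟩ a
  refine h _ a ?_
  change a ∈ (boundary n).obj (op ⦋m.1.len⦌)
  rw [boundary_obj_eq_univ _ _ (m.2.trans_lt hn)]
  trivial

/-! ### Lean Kan complexes and π-finiteness -/

instance (X : SSet.{u}) : KanComplex (kanReplacement X) := kanComplex_kanReplacement X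

lemma WeaklyEquivalent.toKanReplacement (X : SSet.{u}) : WeaklyEquivalent X (kanReplacement X) :=
  .rel _ _ ⟨_, (anodyneExtensions_toKanReplacement X).isWeakEquivalence⟩

instance (n : ℕ) (L : SSet.{u}) (x : L _⦋0⦌) [Finite (L _⦋n⦌)] :
    Finite (SimplicialHomotopyGroup n L x) := by
  have : Finite (RelativeMorphism (boundary n) (Subcomplex.ofSimplex x)
      (const ⟨x, Subcomplex.mem_ofSimplex_obj x⟩)) :=
    Finite.of_injective (fun f ↦ yonedaEquiv f.map)
      (fun f g h ↦ RelativeMorphism.ext (yonedaEquiv.injective h))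
  exact Quot.finite _

lemma IsCoskeletal.subsingleton_simplicialHomotopyGroup (L : SSet.{u}) (N : ℕ)
    [SimplicialObject.IsCoskeletal L N] {n : ℕ} (hn : N < n) (x : L _⦋0⦌) :
    Subsingleton (SimplicialHomotopyGroup n L x) := by
  have : Subsingleton (RelativeMorphism (boundary n) (Subcomplex.ofSimplex x)
      (const ⟨x, Subcomplex.mem_ofSimplex_obj x⟩)) :=
    ⟨fun f g ↦ RelativeMorphism.ext (eq_of_eq_on_boundary N hn _ _ fun m a ha ↦
      (f.map_eq_of_mem a ha).trans (g.map_eq_of_mem a ha).symm)⟩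
  exact Quot.Subsingleton

lemma IsPiFinite.of_weaklyEquivalent {X L : SSet.{u}} [KanComplex L] (hL : IsLean L)
    (h : WeaklyEquivalent X L) : IsPiFinite X := by
  obtain ⟨f, g, hfg⟩ := WeaklyEquivalent.exists_homotopyRetract
    (.trans _ _ _ (.symm _ _ (WeaklyEquivalent.toKanReplacement X)) h)
  constructor
  · intro n x
    obtain ⟨Θ, hΘ⟩ := SimplicialHomotopyGroup.exists_injective f g hfg n
      ((SSet.toKanReplacement X).app _ x)
    have := hL.finite n
    exact Finite.of_injective Θ hΘ
  · obtain ⟨N, _⟩ := hL.exists_isCoskeletal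
    refine ⟨N + 1, fun n hn x ↦ ?_⟩
    obtain ⟨Θ, hΘ⟩ := SimplicialHomotopyGroup.exists_injective f g hfg n
      ((SSet.toKanReplacement X).app _ x)
    have := IsCoskeletal.subsingleton_simplicialHomotopyGroup L N hn
    exact hΘ.subsingleton

/-- π-finiteness only controls base points coming from `X`; this moves any simplex of the
replacement to such a base point. -/
lemma exists_htpyRel_const_toKanReplacement (X : SSet.{u}) {n : ℕ}
    (f : Δ[n] ⟶ kanReplacement X) :
    ∃ x : X _⦋0⦌, HtpyRel ⊥ f (const ((toKanReplacement X).app _ x)) := by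
  obtain ⟨y, hy⟩ := htpyRel_const f
  obtain ⟨x, hx⟩ := (anodyneExtensions_toKanReplacement X).exists_htpyRel_const Δ[n] y
  exact ⟨x, hy.trans hx⟩

lemma eq_on_boundary_of_δ_eq {K : SSet.{u}} {n : ℕ} {a b : K _⦋n + 1⦌}
    (h : ∀ i, K.δ i a = K.δ i b) (m : SimplexCategoryᵒᵖ) (s : Δ[n + 1].obj m)
    (hs : s ∈ (boundary (n + 1)).obj m) :
    (yonedaEquiv.symm a).app m s = (yonedaEquiv.symm b).app m s := by
  have : (boundary (n + 1)).ι ≫ yonedaEquiv.symm a =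
      (boundary (n + 1)).ι ≫ yonedaEquiv.symm b := by
    refine boundary.hom_ext fun i ↦ ?_
    simp only [boundary.ι_ι_assoc, stdSimplex.δ_comp_yonedaEquiv_symm, h]
  exact ConcreteCategory.congr_hom (congr_app this m)
    (⟨s, hs⟩ : ((boundary (n + 1) : SSet)).obj m)

/-- The simplices with a given boundary of a minimal subcomplex of `kanReplacement X` inject in a
homotopy group. -/
lemma Subcomplex.IsMinimal.exists_injective {X : SSet.{u}} {L : (kanReplacement X).Subcomplex}
    (hL : L.IsMinimal) {n : ℕ} (b : kanReplacement X _⦋n⦌) :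
    ∃ (x : X _⦋0⦌) (Θ : {a : (L : SSet) _⦋n⦌ // ∀ m, ∀ s ∈ (boundary n).obj m,
      (yonedaEquiv.symm a.1).app m s = (yonedaEquiv.symm b).app m s} → HomotopyGroup n X x),
      Function.Injective Θ := by
  obtain ⟨x, hx⟩ := exists_htpyRel_const_toKanReplacement X (yonedaEquiv.symm b)
  obtain ⟨Θ, hΘ⟩ := KanComplex.exists_differenceClass _ _ hx
  exact ⟨x, fun a ↦ Θ ⟨yonedaEquiv.symm a.1.1, a.2⟩, fun a a' h ↦
    Subtype.ext (Subtype.ext (hL a.1.2 a'.1.2 (hΘ _ _ h)))⟩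

/-- By induction there are finitely many tuples of faces, and each fibre of the faces map is finite
by minimality. In dimension 0 the boundary is empty, so there is a single fibre. -/
lemma Subcomplex.IsMinimal.finite {X : SSet.{u}} {L : (kanReplacement X).Subcomplex}
    (hL : L.IsMinimal) (hX : IsPiFinite X) (n : ℕ) : Finite ((L : SSet) _⦋n⦌) := by
  have key (n : ℕ) (b : kanReplacement X _⦋n⦌) :
      Finite {a : (L : SSet) _⦋n⦌ // ∀ m, ∀ s ∈ (boundary n).obj m,
        (yonedaEquiv.symm a.1).app m s = (yonedaEquiv.symm b).app m s} := by
    obtain ⟨x, Θ, hΘ⟩ := hL.exists_injective b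
    have := hX.finite n x
    exact Finite.of_injective Θ hΘ
  induction n with
  | zero =>
    rcases isEmpty_or_nonempty ((L : SSet) _⦋0⦌) with _ | ⟨⟨b⟩⟩
    · infer_instance
    have := key 0 b.1
    refine Finite.of_injective (β := {a : (L : SSet) _⦋0⦌ // ∀ m, ∀ s ∈ (boundary 0).obj m,
      (yonedaEquiv.symm a.1).app m s = (yonedaEquiv.symm b.1).app m s})
      (fun a ↦ ⟨a, fun m s hs ↦ ?_⟩) (fun a a' h ↦ congrArg Subtype.val h)
    rw [boundary_zero] at hs
    exact hs.elim
  | succ n hn =>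
    rw [← Set.finite_univ_iff]
    refine Set.Finite.of_finite_fibers
      (fun (a : (L : SSet) _⦋n + 1⦌) (i : Fin (n + 2)) ↦ (L : SSet).δ i a) (Set.toFinite _) ?_
    rintro _ ⟨b, -, rfl⟩
    exact Set.Finite.subset (Set.finite_coe_iff.1 (key (n + 1) b.1))
      fun a ha ↦ eq_on_boundary_of_δ_eq fun i ↦ congrArg Subtype.val (congrFun ha.2 i)

lemma Subcomplex.IsMinimal.eq_of_δ_eq {X : SSet.{u}} {L : (kanReplacement X).Subcomplex}
    (hL : L.IsMinimal) {n : ℕ} (hX : ∀ x : X _⦋0⦌, Subsingleton (HomotopyGroup (n + 1) X x))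
    (a b : (L : SSet) _⦋n + 1⦌) (h : ∀ i, (L : SSet).δ i a = (L : SSet).δ i b) : a = b := by
  obtain ⟨x, Θ, hΘ⟩ := hL.exists_injective b.1
  have := hX x
  have := hΘ.subsingleton
  exact congrArg Subtype.val (Subsingleton.elim
    (α := {a : (L : SSet) _⦋n + 1⦌ // ∀ m, ∀ s ∈ (boundary (n + 1)).obj m,
      (yonedaEquiv.symm a.1).app m s = (yonedaEquiv.symm b.1).app m s})
    ⟨a, eq_on_boundary_of_δ_eq fun i ↦ congrArg Subtype.val (h i)⟩ ⟨b, fun _ _ _ ↦ rfl⟩)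

lemma IsPiFinite.exists_weaklyEquivalent {X : SSet.{u}} (hX : IsPiFinite X) :
    ∃ L : SSet.{u}, KanComplex L ∧ IsLean L ∧ WeaklyEquivalent X L := by
  obtain ⟨L, hL⟩ := Subcomplex.exists_maximal_isMinimal (kanReplacement X)
  have hmin : L.IsMinimal := hL.1
  obtain ⟨r, hr, hr'⟩ := (Subcomplex.isCompressing_of_maximal hL).exists_retraction
  have := KanComplex.of_retract L.ι r hr
  obtain ⟨n₀, hn₀⟩ := hX.exists_trivial
  -- The maximum with 1 secures the nonzero level required by `KanComplex.isCoskeletal`.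
  refine ⟨L, inferInstance, ⟨hmin.finite hX, max 1 n₀, ?_⟩, ?_⟩
  · exact KanComplex.isCoskeletal _
      (fun n hn ↦ hmin.eq_of_δ_eq (hn₀ _ ((le_max_right _ _).trans hn))) (by lia)
  · exact .trans _ _ _ (WeaklyEquivalent.toKanReplacement X)
      (.symm _ _ (.rel _ _ ⟨_, isWeakEquivalence_of_retraction L.ι r hr hr'⟩))

end SSet

theorem mainTheorem6 (X : SSet.{u}) :
    SSet.IsPiFinite X ↔
      ∃ L : SSet.{u}, SSet.KanComplex L ∧ SSet.IsLean L ∧ SSet.WeaklyEquivalent X L :=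
  ⟨fun h ↦ h.exists_weaklyEquivalent, fun ⟨_, _, hL, h⟩ ↦ .of_weaklyEquivalent hL h⟩
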